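/- **Setting.** Let $\mathbb N=\{0,1,2,\dots\}$, $\mathbb N_{>0}=\{1,2,\dots\}$. Let $\mathcal{LC}$ be the set of sequences $M=(M_j)_{j\in\mathbb N}$ of positive reals with $1=M_0\le M_1$, $M_j^2\le M_{j-1}M_{j+1}$ for all $j\ge 1$, and $\lim_{j\to\infty}(M_j)^{1/j}=+\infty$. For $M\in\mathcal{LC}$ put $\omega_M(t):=\sup_{j\in\mathbb N}\log(t^j/M_j)$ for $t>0$, $\omega_M(0):=0$, and $v_M(t):=\exp(-\omega_M(t))$, $t\ge 0$. A weight is a continuous, non-increasing function $v:[0,\infty)\to(0,\infty)$ with $\lim_{t\to\infty}t^kv(t)=0$ for all $k\ge 0$; each $v_M$ is a weight. For $c>0$ let $v_c(t):=v(ct)$ and $v^c(t):=v(t)^c$. For weights $v,w$ write $v\vartriangleleft w$ if $w(t)=o(v(t))$ as $t\to\infty$; write $v\vartriangleleft_{\mathfrak c}w$ if $v\vartriangleleft w_c$ for all $c>0$, and $v\vartriangleleft^{\mathfrak c}w$ if $v\vartriangleleft w^c$ for all $c>0$. Write $M\vartriangleleft N$ if for every $h>0$ there is $C_h\ge1$ with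 $M_j\le C_hh^jN_j$ for all $j\in\mathbb N$. Let $H^\infty_v(\mathbb C)$ be the space of entire functions $f$ with $\|f\|_v:=\sup_{z\in\mathbb C}|f(z)|v(|z|)<\infty$, normed by $\|\cdot\|_v$. Let $H^\infty_{\underline{\mathcal N}^{\mathfrak c}}(\mathbb C)$ be the inductive limit $\varinjlim_{n\in\mathbb N_{>0}}H^\infty_{v_N^{n}}(\mathbb C)$ (the union, with the finest locally convex topology making all the inclusions continuous), and $H^\infty_{\overline{\mathcal M}^{\mathfrak c}}(\mathbb C)$ the projective limit $\varprojlim_{n\in\mathbb N_{>0}}H^\infty_{v_M^{1/n}}(\mathbb C)$ (the intersection, with the coarsest topology making all the inclusions continuous). **Theorem.** Let $M,N\in\mathcal{LC}$. The following are equivalent: 1. for every $d\in\mathbb N_{>0}$ there is $C\ge1$ with $(M_{dj})^{1/d}\le C N_j$ for all $j\in\mathbb N$; 2. $v_N\vartriangleleft^{\mathfrak c}v_M$; 3. $\omega_N(t)=o(\omega_M(t))$ as $t\to\infty$; 4. for all $c,c'>0$: $H^\infty_{v_N^c}(\mathbb C)\subseteq H^\infty_{v_M^{c'}}(\mathbb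 C)$ with continuous inclusion; 5. there is $c>0$ such that for all $c'>0$: $H^\infty_{v_N^c}(\mathbb C)\subseteq H^\infty_{v_M^{c'}}(\mathbb C)$ with continuous inclusion; 6. $H^\infty_{\underline{\mathcal N}^{\mathfrak c}}(\mathbb C)\subseteq H^\infty_{\overline{\mathcal M}^{\mathfrak c}}(\mathbb C)$ with continuous inclusion. Suppose moreover that at least one $P\in\{M,N\}$ satisfies $$\exists\,C\ge1\ \forall\,j,k\in\mathbb N:\quad P_{j+k}\le C^{j+k}P_jP_k,$$ and that at least one $Q\in\{M,N\}$ (possibly different from $P$) satisfies $$\exists\,L\in\mathbb N_{>0}:\quad \liminf_{j\to\infty}\frac{(Q_{Lj})^{1/(Lj)}}{(Q_j)^{1/j}}>1 .$$ Then 1.–6. are also equivalent to each of 7. $M\vartriangleleft N$; 8. $v_N\vartriangleleft_{\mathfrak c}v_M$. -/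

import Mathlib

open Filter Topology Asymptotics

noncomputable section

namespace WeightedEntire

/-! ### Weights -/

/-- A weight: a strictly positive, continuous, non-increasing and rapidly decreasing function on
`[0, ∞)`. Only the values at `t ≥ 0` matter. -/
structure Weight where
  toFun : ℝ → ℝ
  pos : ∀ t, 0 ≤ t → 0 < toFun t
  continuousOn : ContinuousOn toFun (Set.Ici 0)
  antitoneOn : AntitoneOn toFun (Set.Ici 0)
  rapid : ∀ k : ℝ, 0 ≤ k → Tendsto (fun t : ℝ => t ^ k * toFun t) atTop (𝓝 0)

instance : CoeFun Weight (fun _ => ℝ → ℝ) := ⟨Weight.toFun⟩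

/-- The dilated weight `v_c : t ↦ v (c t)`. -/
def Weight.dilate (v : Weight) (c : ℝ) (hc : 0 < c) : Weight where
  toFun t := v (c * t)
  pos t ht := v.pos _ (mul_nonneg hc.le ht)
  continuousOn := v.continuousOn.comp (by fun_prop) fun t ht => mul_nonneg hc.le ht
  antitoneOn a ha b hb hab := v.antitoneOn (mul_nonneg hc.le ha) (mul_nonneg hc.le hb)
    (mul_le_mul_of_nonneg_left hab hc.le)
  rapid k hk := by
    have h := ((v.rapid k hk).comp (tendsto_id.const_mul_atTop hc)).const_mul (c ^ (-k))
    rw [mul_zero] at h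
    refine h.congr' ?_
    filter_upwards [eventually_ge_atTop 0] with t ht
    have hck : c ^ (-k) * c ^ k = 1 := by rw [← Real.rpow_add hc]; simp
    simp only [Function.comp, id]
    rw [Real.mul_rpow hc.le ht, ← mul_assoc, ← mul_assoc, hck, one_mul]

/-- The power weight `v^c : t ↦ v(t)^c`. -/
def Weight.power (v : Weight) (c : ℝ) (hc : 0 < c) : Weight where
  toFun t := v t ^ c
  pos t ht := Real.rpow_pos_of_pos (v.pos t ht) c
  continuousOn := v.continuousOn.rpow_const fun _ _ => Or.inr hc.le
  antitoneOn a ha b hb hab := Real.rpow_le_rpow (v.pos b hb).le (v.antitoneOn ha hb hab) hc.le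
  rapid k hk := by
    have h := (v.rapid (k / c) (div_nonneg hk hc.le)).rpow_const (p := c) (Or.inr hc.le)
    rw [Real.zero_rpow hc.ne'] at h
    refine h.congr' ?_
    filter_upwards [eventually_ge_atTop 0] with t ht
    rw [Real.mul_rpow (Real.rpow_nonneg ht _) (v.pos t ht).le, ← Real.rpow_mul ht,
      div_mul_cancel₀ k hc.ne']

/-- `v ◁ w`: `w(t) = o(v(t))` as `t → ∞`. -/
def Weight.StrongLT (v w : Weight) : Prop := w.toFun =o[atTop] v.toFun

/-- The dilatation-type relation `v ◁_c w`: `v ◁ w_c` for every `c > 0`. -/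
def Weight.StrongLTDilate (v w : Weight) : Prop :=
  ∀ (c : ℝ) (hc : 0 < c), v.StrongLT (w.dilate c hc)

/-- The exponential-type relation `v ◁^c w`: `v ◁ w^c` for every `c > 0`. -/
def Weight.StrongLTPower (v w : Weight) : Prop :=
  ∀ (c : ℝ) (hc : 0 < c), v.StrongLT (w.power c hc)

/-! ### Weight sequences -/

/-- The class `LC` of normalized log-convex sequences of positive reals with
`(M_j)^{1/j} → ∞`. -/
structure LC (M : ℕ → ℝ) : Prop where
  pos : ∀ j, 0 < M j
  zero : M 0 = 1
  one_le : 1 ≤ M 1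
  logConvex : ∀ j, 1 ≤ j → M j ^ 2 ≤ M (j - 1) * M (j + 1)
  root_tendsto : Tendsto (fun j : ℕ => M j ^ (1 / (j : ℝ))) atTop atTop

/-- Moderate growth `(mg)`. -/
def ModerateGrowth (M : ℕ → ℝ) : Prop :=
  ∃ C : ℝ, 1 ≤ C ∧ ∀ j k : ℕ, M (j + k) ≤ C ^ (j + k) * M j * M k

/-- `∃ L ≥ 1, liminf_j (M_{Lj})^{1/(Lj)} / (M_j)^{1/j} > 1`; the lower limit is taken in the
extended reals. -/
def RootGrowth (M : ℕ → ℝ) : Prop :=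
  ∃ L : ℕ, 0 < L ∧ (1 : EReal) < liminf (fun j : ℕ =>
    ((M (L * j) ^ (1 / ((L * j : ℕ) : ℝ)) / M j ^ (1 / (j : ℝ)) : ℝ) : EReal)) atTop

/-- `M ◁ N`. -/
def SeqStrongLT (M N : ℕ → ℝ) : Prop :=
  ∀ h : ℝ, 0 < h → ∃ C : ℝ, 1 ≤ C ∧ ∀ j : ℕ, M j ≤ C * h ^ j * N j

/-- The associated weight function `ω_M(t) = sup_j log (t^j / M_j)` for `t > 0`, `ω_M(0) = 0`.
For `M` in `LC` the supremum is finite (see `LC.bddAbove_log`). -/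
def omega (M : ℕ → ℝ) (t : ℝ) : ℝ :=
  if t = 0 then 0 else ⨆ j : ℕ, Real.log (t ^ j / M j)

lemma LC.le_succ {M : ℕ → ℝ} (hM : LC M) (j : ℕ) : M j ≤ M (j + 1) := by
  induction j with
  | zero => simpa [hM.zero] using hM.one_le
  | succ j ih =>
    have h := hM.logConvex (j + 1) (by omega)
    simp only [Nat.add_sub_cancel] at h
    have h1 := hM.pos (j + 1)
    have h2 := hM.pos (j + 1 + 1)
    nlinarith [mul_le_mul_of_nonneg_right ih h2.le]

lemma LC.one_le_all {M : ℕ → ℝ} (hM : LC M) (j : ℕ) : 1 ≤ M j := by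
  have := monotone_nat_of_le_succ hM.le_succ (Nat.zero_le j)
  rwa [hM.zero] at this

lemma LC.bddAbove_log {M : ℕ → ℝ} (hM : LC M) {t : ℝ} (ht : 0 < t) :
    BddAbove (Set.range fun j : ℕ => Real.log (t ^ j / M j)) := by
  refine (isBoundedUnder_of_eventually_le (a := (0 : ℝ)) ?_).bddAbove_range
  filter_upwards [hM.root_tendsto.eventually_ge_atTop t, eventually_gt_atTop 0] with j hj hj0
  apply Real.log_nonpos (div_nonneg (pow_nonneg ht.le _) (hM.pos j).le)
  rw [div_le_one (hM.pos j)]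
  calc t ^ j ≤ (M j ^ (1 / (j : ℝ))) ^ j := pow_le_pow_left₀ ht.le hj j
    _ = M j := by
      rw [← Real.rpow_natCast, ← Real.rpow_mul (hM.pos j).le, one_div,
        inv_mul_cancel₀ (by positivity), Real.rpow_one]

lemma LC.le_omega {M : ℕ → ℝ} (hM : LC M) {t : ℝ} (ht : 0 < t) (j : ℕ) :
    Real.log (t ^ j / M j) ≤ omega M t := by
  rw [omega, if_neg ht.ne']
  exact le_ciSup (hM.bddAbove_log ht) j

lemma LC.omega_nonneg {M : ℕ → ℝ} (hM : LC M) {t : ℝ} (ht : 0 ≤ t) : 0 ≤ omega M t := by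
  rcases ht.eq_or_lt with rfl | ht
  · simp [omega]
  · simpa [hM.zero] using hM.le_omega ht 0

lemma LC.omega_mono {M : ℕ → ℝ} (hM : LC M) : MonotoneOn (omega M) (Set.Ici 0) := by
  intro a ha b hb hab
  rcases (show (0 : ℝ) ≤ a from ha).eq_or_lt with rfl | ha
  · simpa [omega] using hM.omega_nonneg hb
  · rw [omega, if_neg ha.ne']
    refine ciSup_le fun j => le_trans ?_ (hM.le_omega (ha.trans_le hab) j)
    have := hM.pos j
    gcongr

lemma LC.omega_eq_zero {M : ℕ → ℝ} (hM : LC M) {t : ℝ} (ht : 0 ≤ t) (ht1 : t ≤ 1) :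
    omega M t = 0 := by
  refine le_antisymm ?_ (hM.omega_nonneg ht)
  rw [omega]
  split_ifs
  · exact le_rfl
  · refine ciSup_le fun j => Real.log_nonpos (div_nonneg (pow_nonneg ht _) (hM.pos j).le) ?_
    rw [div_le_one (hM.pos j)]
    exact (pow_le_one₀ ht ht1).trans (hM.one_le_all j)

lemma LC.omega_convex {M : ℕ → ℝ} (hM : LC M) :
    ConvexOn ℝ Set.univ fun s => omega M (Real.exp s) := by
  have key : ∀ (s : ℝ) (j : ℕ),
      Real.log (Real.exp s ^ j / M j) = j * s - Real.log (M j) := fun s j => by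
    rw [Real.log_div (by positivity) (hM.pos j).ne', Real.log_pow, Real.log_exp]
  refine ⟨convex_univ, fun x _ y _ a b ha hb hab => ?_⟩
  have hx := fun j => hM.le_omega (Real.exp_pos x) j
  have hy := fun j => hM.le_omega (Real.exp_pos y) j
  simp only [key] at hx hy
  simp only [smul_eq_mul]
  conv_lhs => rw [omega, if_neg (Real.exp_pos _).ne']
  refine ciSup_le fun j => ?_
  rw [key]
  have h1 := mul_le_mul_of_nonneg_left (hx j) ha
  have h2 := mul_le_mul_of_nonneg_left (hy j) hb
  have h3 : Real.log (M j) = a * Real.log (M j) + b * Real.log (M j) := by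
    rw [← add_mul, hab, one_mul]
  linarith

lemma LC.omega_continuousOn {M : ℕ → ℝ} (hM : LC M) :
    ContinuousOn (omega M) (Set.Ici 0) := by
  intro t ht
  rcases (show (0 : ℝ) ≤ t from ht).eq_or_lt with rfl | ht
  · have h : (fun _ : ℝ => (0 : ℝ)) =ᶠ[𝓝[Set.Ici 0] 0] omega M := by
      filter_upwards [self_mem_nhdsWithin,
        mem_nhdsWithin_of_mem_nhds (Iic_mem_nhds (zero_lt_one (α := ℝ)))] with s h0 h1
      exact (hM.omega_eq_zero h0 h1).symm
    exact (continuousWithinAt_const.congr_of_eventuallyEq h.symm (by simp [omega]))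
  · have hc : Continuous fun s => omega M (Real.exp s) :=
      continuousOn_univ.1 (hM.omega_convex.continuousOn isOpen_univ)
    have h2 : ContinuousAt (fun s => omega M (Real.exp (Real.log s))) t :=
      hc.continuousAt.comp (f := Real.log) (Real.continuousAt_log ht.ne')
    refine (h2.congr ?_).continuousWithinAt
    filter_upwards [Ioi_mem_nhds ht] with s hs
    rw [Real.exp_log hs]

/-- The weight `v_M = exp(-ω_M)`, for `M` in `LC`. -/
def LC.weight {M : ℕ → ℝ} (hM : LC M) : Weight where
  toFun t := Real.exp (-omega M t)
  pos _ _ := Real.exp_pos _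
  continuousOn := Real.continuous_exp.comp_continuousOn hM.omega_continuousOn.neg
  antitoneOn _ ha _ hb hab := Real.exp_le_exp.2 (neg_le_neg (hM.omega_mono ha hb hab))
  rapid k hk := by
    obtain ⟨n, hn⟩ := exists_nat_ge k
    have h0 : Tendsto (fun t : ℝ => M (n + 1) * t⁻¹) atTop (𝓝 0) := by
      simpa using tendsto_inv_atTop_zero.const_mul (M (n + 1))
    refine tendsto_of_tendsto_of_tendsto_of_le_of_le' tendsto_const_nhds h0 ?_ ?_
    · filter_upwards [eventually_ge_atTop 0] with t ht using by positivity
    · filter_upwards [eventually_ge_atTop 1] with t ht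
      have ht0 : 0 < t := by linarith
      have hp := hM.pos (n + 1)
      have h1 := Real.exp_le_exp.2 (neg_le_neg (hM.le_omega ht0 (n + 1)))
      rw [Real.exp_neg (Real.log _), Real.exp_log (by positivity), inv_div] at h1
      have h2 : t ^ k ≤ t ^ n := by
        rw [← Real.rpow_natCast]
        exact Real.rpow_le_rpow_of_exponent_le ht hn
      calc t ^ k * Real.exp (-omega M t) ≤ t ^ n * (M (n + 1) / t ^ (n + 1)) := by gcongr
        _ = M (n + 1) * t⁻¹ := by rw [pow_succ]; field_simp

/-! ### Weighted spaces of entire functions -/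

/-- The linear subspace of entire functions in `ℂ → ℂ`. -/
def entireSubmodule : Submodule ℂ (ℂ → ℂ) where
  carrier := {f | Differentiable ℂ f}
  add_mem' hf hg := Differentiable.add hf hg
  zero_mem' := differentiable_const 0
  smul_mem' c _ hf := Differentiable.const_smul hf c

/-- The vector space `H(ℂ)` of entire functions. It is not reducible to a subtype of `ℂ → ℂ`, so
that its subspaces do not inherit the topology of pointwise convergence. -/
def Entire : Type := entireSubmodule

instance : AddCommGroup Entire := inferInstanceAs (AddCommGroup entireSubmodule)
instance : Module ℂ Entire := inferInstanceAs (Module ℂ entireSubmodule)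

/-- The function underlying an element of `H(ℂ)`. -/
def Entire.toFun (f : Entire) : ℂ → ℂ := Subtype.val (p := fun g => g ∈ entireSubmodule) f

instance : CoeFun Entire (fun _ => ℂ → ℂ) := ⟨Entire.toFun⟩

/-- The element of `H(ℂ)` given by an entire function. -/
def Entire.mk (f : ℂ → ℂ) (hf : Differentiable ℂ f) : Entire :=
  (⟨f, hf⟩ : entireSubmodule)

@[simp] lemma Entire.mk_apply (f : ℂ → ℂ) (hf : Differentiable ℂ f) (z : ℂ) :
    Entire.mk f hf z = f z := rfl

lemma Entire.differentiable (f : Entire) : Differentiable ℂ f :=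
  Subtype.property (p := fun g => g ∈ entireSubmodule) f

lemma Entire.ext {f g : Entire} (h : ∀ z, f z = g z) : f = g := Subtype.ext (funext h)

@[simp] lemma Entire.zero_apply (z : ℂ) : (0 : Entire) z = 0 := rfl

@[simp] lemma Entire.add_apply (f g : Entire) (z : ℂ) : (f + g) z = f z + g z := rfl

@[simp] lemma Entire.neg_apply (f : Entire) (z : ℂ) : (-f) z = -f z := rfl

@[simp] lemma Entire.smul_apply (c : ℂ) (f : Entire) (z : ℂ) : (c • f) z = c * f z := rfl

/-- The space `H^∞_v(ℂ)` of entire functions with `sup_z |f(z)| v(|z|) < ∞`. -/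
def HInf (v : Weight) : Submodule ℂ Entire where
  carrier := {f | BddAbove (Set.range fun z : ℂ => ‖f z‖ * v ‖z‖)}
  add_mem' := by
    rintro f g ⟨A, hA⟩ ⟨B, hB⟩
    refine ⟨A + B, ?_⟩
    rintro _ ⟨z, rfl⟩
    have h1 : ‖f z‖ * v ‖z‖ ≤ A := hA ⟨z, rfl⟩
    have h2 : ‖g z‖ * v ‖z‖ ≤ B := hB ⟨z, rfl⟩
    have h3 : ‖f z + g z‖ ≤ ‖f z‖ + ‖g z‖ := norm_add_le (f z) (g z)
    have := mul_le_mul_of_nonneg_right h3 (v.pos _ (norm_nonneg z)).le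
    simp only [Entire.add_apply]
    linarith
  zero_mem' := ⟨0, by
    rintro _ ⟨z, rfl⟩
    simp⟩
  smul_mem' := by
    rintro c f ⟨A, hA⟩
    refine ⟨‖c‖ * A, ?_⟩
    rintro _ ⟨z, rfl⟩
    have h1 : ‖f z‖ * v ‖z‖ ≤ A := hA ⟨z, rfl⟩
    simp only [Entire.smul_apply, norm_mul, mul_assoc]
    exact mul_le_mul_of_nonneg_left h1 (norm_nonneg c)

/-- The norm `‖f‖_v = sup_z |f(z)| v(|z|)` of `H^∞_v(ℂ)`. -/
def HInf.addGroupNorm (v : Weight) : AddGroupNorm (HInf v) where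
  toFun f := ⨆ z : ℂ, ‖f.1 z‖ * v ‖z‖
  map_zero' := by simp
  add_le' f g := by
    refine ciSup_le fun z => ?_
    have h3 : ‖f.1 z + g.1 z‖ ≤ ‖f.1 z‖ + ‖g.1 z‖ := norm_add_le (f.1 z) (g.1 z)
    have h := mul_le_mul_of_nonneg_right h3 (v.pos _ (norm_nonneg z)).le
    have h1 := le_ciSup f.2 z
    have h2 := le_ciSup g.2 z
    simp only [Submodule.coe_add, Entire.add_apply] at h1 h2 ⊢
    linarith
  neg' f := by simp
  eq_zero_of_map_eq_zero' f hf := by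
    refine Subtype.ext (Entire.ext fun z => ?_)
    have h1 : ‖f.1 z‖ * v ‖z‖ ≤ 0 := (le_ciSup f.2 z).trans_eq hf
    have h2 := v.pos _ (norm_nonneg z)
    have h3 : ‖f.1 z‖ = 0 := by nlinarith [norm_nonneg (f.1 z)]
    exact norm_eq_zero.1 h3

instance (v : Weight) : NormedAddCommGroup (HInf v) :=
  (HInf.addGroupNorm v).toNormedAddCommGroup

lemma HInf.norm_def {v : Weight} (f : HInf v) : ‖f‖ = ⨆ z : ℂ, ‖f.1 z‖ * v ‖z‖ := rfl

instance (v : Weight) : NormedSpace ℂ (HInf v) where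
  norm_smul_le c f := by
    simp only [HInf.norm_def, Submodule.coe_smul, Entire.smul_apply, norm_mul, mul_assoc]
    rw [Real.mul_iSup_of_nonneg (norm_nonneg c)]

/-- The underlying space of the inductive limit of the spaces `H^∞_{v_n}(ℂ)`: the linear span of
their union (which is the union itself when the sequence of weights is non-increasing). -/
def HInd (V : ℕ+ → Weight) : Submodule ℂ Entire := ⨆ n, HInf (V n)

/-- The underlying space of the projective limit: the intersection of the `H^∞_{v_n}(ℂ)`. -/
def HProj (V : ℕ+ → Weight) : Submodule ℂ Entire := ⨅ n, HInf (V n)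

lemma le_HInd (V : ℕ+ → Weight) (n : ℕ+) : HInf (V n) ≤ HInd V := le_iSup (fun n => HInf (V n)) n

lemma HProj_le (V : ℕ+ → Weight) (n : ℕ+) : HProj V ≤ HInf (V n) := iInf_le (fun n => HInf (V n)) n

/-- The (LB)-topology: the finest locally convex vector space topology for which all the
inclusions `H^∞_{v_n}(ℂ) → HInd V` are continuous. -/
instance (V : ℕ+ → Weight) : TopologicalSpace (HInd V) :=
  sInf {t | (∀ n, @Continuous _ _ inferInstance t (Submodule.inclusion (le_HInd V n))) ∧
    @IsTopologicalAddGroup (HInd V) t _ ∧ @ContinuousSMul ℂ (HInd V) _ _ t ∧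
    @LocallyConvexSpace ℝ (HInd V) _ _ _ _ t}

/-- The projective topology: the coarsest topology for which all the inclusions
`HProj V → H^∞_{v_n}(ℂ)` are continuous. -/
instance (V : ℕ+ → Weight) : TopologicalSpace (HProj V) :=
  ⨅ n, TopologicalSpace.induced (Submodule.inclusion (HProj_le V n)) inferInstance

/-- `S ⊆ T` with continuous inclusion. -/
def ContinuousIncl (S T : Submodule ℂ Entire) [TopologicalSpace S] [TopologicalSpace T] : Prop :=
  ∃ h : S ≤ T, Continuous (Submodule.inclusion h)

/-- The exponential-type system `(v^n)_{n ≥ 1}`. -/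
def Weight.lowerPowers (v : Weight) (n : ℕ+) : Weight := v.power (n : ℝ) (by positivity)

/-- The exponential-type system `(v^{1/n})_{n ≥ 1}`. -/
def Weight.upperPowers (v : Weight) (n : ℕ+) : Weight := v.power (1 / (n : ℝ)) (by positivity)

end WeightedEntire

end

namespace WeightedEntire

/-! ### Log-convex sequences and their associated weight functions -/

section Sequences

variable {M N : ℕ → ℝ}

/-! After taking logarithms every condition compares ω_N with ω_M. Log-convexity gives the duality
log M_j = sup_t (j log t - ω_M(t)), attained by `LC.exists_log_le`, so a bound ω_N ≤ ω_M/d + K is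
the same as M_{dj}^{1/d} ≤ e^K N_j. Errors of size O(log t) are harmless, since log t = o(ω_M).

If ω_N = o(ω_M), then v_M^{c'} ≤ A v_N^c and the inclusions follow. Conversely, monomials suffice as
test functions (`isLittleO_of_continuousIncl`): for m > 1/c the norm of z^j in the space of v_N^c is
at most N_{mj}^{1/m}, and the resulting inequalities bound the terms of ω_N at the multiples of m,
which determine ω_N up to m log t. Condition 6 reduces to this by factoring through the limits.

The same duality, with the factor h^j acting as a dilation, makes 7 and 8 equivalent without growth
conditions. Moderate growth costs only a factor e^{Dj}, which M ◁ N absorbs, so 7 implies 1. Root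
growth makes dilations cost only a constant multiple of ω, which the little-o absorbs, so 3 implies
8. -/

lemma log_pow_div {M : ℕ → ℝ} (hM : LC M) {t : ℝ} (ht : 0 < t) (j : ℕ) :
    Real.log (t ^ j / M j) = j * Real.log t - Real.log (M j) := by
  rw [Real.log_div (by positivity) (hM.pos j).ne', Real.log_pow]

lemma LC.mul_log_sub_le_omega (hM : LC M) {t : ℝ} (ht : 0 < t) (j : ℕ) :
    j * Real.log t - Real.log (M j) ≤ omega M t :=
  log_pow_div hM ht j ▸ hM.le_omega ht j

lemma LC.omega_le (hM : LC M) {t B : ℝ} (ht : 0 < t)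
    (h : ∀ j : ℕ, j * Real.log t - Real.log (M j) ≤ B) : omega M t ≤ B := by
  rw [omega, if_neg ht.ne']
  exact ciSup_le fun j => (log_pow_div hM ht j).trans_le (h j)

lemma LC.log_nonneg (hM : LC M) (j : ℕ) : 0 ≤ Real.log (M j) :=
  Real.log_nonneg (hM.one_le_all j)

lemma LC.monotone (hM : LC M) : Monotone M := monotone_nat_of_le_succ hM.le_succ

/-- The logarithms of the quotients `M_{j+1} / M_j` increase. -/
lemma LC.monotone_log_quotient (hM : LC M) :
    Monotone fun j => Real.log (M (j + 1)) - Real.log (M j) := by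
  refine monotone_nat_of_le_succ fun j => ?_
  have h := Real.log_le_log (by have := hM.pos (j + 1); positivity)
    (hM.logConvex (j + 1) (by omega))
  rw [Nat.add_sub_cancel, Real.log_mul (hM.pos _).ne' (hM.pos _).ne', Real.log_pow] at h
  push_cast at h
  linarith

/-- A log-convex sequence is recovered from its associated weight function. -/
lemma LC.exists_log_le (hM : LC M) (j : ℕ) :
    ∃ t : ℝ, 0 < t ∧ Real.log (M j) ≤ j * Real.log t - omega M t := by
  -- At t = M_{j+1}/M_j the supremum defining ω_M is attained at the index j: k ↦ log M_k lies above
  -- its line of slope x through j.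
  set x := Real.log (M (j + 1)) - Real.log (M j) with hx
  have up : ∀ n : ℕ, Real.log (M j) + n * x ≤ Real.log (M (j + n)) := by
    intro n
    induction n with
    | zero => simp
    | succ n ih =>
      have := hM.monotone_log_quotient (Nat.le_add_right j n)
      simp only [← hx] at this
      rw [← add_assoc]
      push_cast
      linarith
  have down : ∀ n k : ℕ, k + n ≤ j → Real.log (M (k + n)) ≤ Real.log (M k) + n * x := by
    intro n k hk
    induction n with
    | zero => simp
    | succ n ih =>
      have := hM.monotone_log_quotient (show k + n ≤ j by omega)
      simp only [← hx] at this
      have := ih (by omega)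
      rw [← add_assoc]
      push_cast
      linarith
  refine ⟨Real.exp x, Real.exp_pos x, ?_⟩
  suffices omega M (Real.exp x) ≤ j * x - Real.log (M j) by
    rw [Real.log_exp]; linarith
  refine hM.omega_le (Real.exp_pos x) fun k => ?_
  rw [Real.log_exp]
  rcases le_total j k with h | h
  · obtain ⟨n, rfl⟩ := Nat.exists_eq_add_of_le h
    have := up n
    push_cast
    linarith
  · obtain ⟨n, hn⟩ := Nat.exists_eq_add_of_le h
    have := down n k hn.ge
    rw [← hn] at this
    rw [hn]
    push_cast
    rw [← hn]
    linarith

/-- Sampling the supremum defining `ω_M` at the multiples of `m` costs at most `m log t`. -/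
lemma LC.omega_le_of_multiples (hM : LC M) {m : ℕ} (hm : 0 < m) {t B : ℝ} (ht : 1 ≤ t)
    (h : ∀ j : ℕ, (m * j : ℕ) * Real.log t - Real.log (M (m * j)) ≤ B) :
    omega M t ≤ m * Real.log t + B := by
  have hl := Real.log_nonneg ht
  refine hM.omega_le (by linarith) fun k => ?_
  -- Round k down to a multiple of m: M does not grow, and at most a factor t^m is lost.
  have h1 := h (k / m)
  have h2 := Real.log_le_log (hM.pos _) (hM.monotone (Nat.mul_div_le k m))
  have h3 : (k : ℝ) ≤ (m * (k / m) : ℕ) + m := by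
    have := Nat.div_add_mod k m
    have := (Nat.mod_lt k hm).le
    exact_mod_cast (by omega : k ≤ m * (k / m) + m)
  nlinarith [mul_le_mul_of_nonneg_right h3 hl]

/-- A single term of the supremum, with index k ≥ A + 1, is enough: the spare log t pays for log
M_k. -/
lemma LC.eventually_mul_log_le_omega (hM : LC M) (A : ℝ) :
    ∀ᶠ t in atTop, A * Real.log t ≤ omega M t := by
  obtain ⟨k, hk⟩ := exists_nat_ge (A + 1)
  filter_upwards [Real.tendsto_log_atTop.eventually_ge_atTop (Real.log (M k)),
    eventually_ge_atTop 1] with t h1 ht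
  have := hM.mul_log_sub_le_omega (by linarith) k
  nlinarith [mul_le_mul_of_nonneg_right hk (Real.log_nonneg ht)]

lemma LC.tendsto_omega (hM : LC M) : Tendsto (omega M) atTop atTop :=
  tendsto_atTop_mono' _ ((hM.eventually_mul_log_le_omega 1).mono fun t ht => one_mul (Real.log t) ▸ ht)
    Real.tendsto_log_atTop

/-! ### Comparison of ω_N with ω_M -/

lemma omega_isLittleO_of (hM : LC M) (hN : LC N)
    (h : ∀ ε : ℝ, 0 < ε → ∃ A K : ℝ, ∀ᶠ t in atTop,
      omega N t ≤ A * Real.log t + K + ε * omega M t) : omega N =o[atTop] omega M := by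
  refine isLittleO_iff.2 fun ε hε => ?_
  obtain ⟨A, K, hAK⟩ := h (ε / 3) (by positivity)
  filter_upwards [hAK, hM.eventually_mul_log_le_omega (3 / ε * A),
    hM.tendsto_omega.eventually_ge_atTop (3 / ε * K), eventually_ge_atTop 0] with t h1 h2 h3 ht
  rw [Real.norm_of_nonneg (hN.omega_nonneg ht), Real.norm_of_nonneg (hM.omega_nonneg ht)]
  have h4 := mul_le_mul_of_nonneg_left h2 (show 0 ≤ ε / 3 by positivity)
  have h5 := mul_le_mul_of_nonneg_left h3 (show 0 ≤ ε / 3 by positivity)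
  have e1 : ε / 3 * (3 / ε * A * Real.log t) = A * Real.log t := by field_simp
  have e2 : ε / 3 * (3 / ε * K) = K := by field_simp
  linarith

lemma eventually_omega_le (hM : LC M) (hN : LC N) (h : omega N =o[atTop] omega M)
    {ε : ℝ} (hε : 0 < ε) : ∀ᶠ t in atTop, omega N t ≤ ε * omega M t := by
  filter_upwards [isLittleO_iff.1 h hε, eventually_ge_atTop 0] with t h1 ht
  rwa [Real.norm_of_nonneg (hN.omega_nonneg ht), Real.norm_of_nonneg (hM.omega_nonneg ht)] at h1

/-- An eventual upper bound of `ω_N` by a nonnegative function holds everywhere up to a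
constant. -/
lemma LC.exists_omega_le_add (hN : LC N) {g : ℝ → ℝ} (hg : ∀ t, 0 ≤ t → 0 ≤ g t)
    (h : ∀ᶠ t in atTop, omega N t ≤ g t) :
    ∃ K : ℝ, 0 ≤ K ∧ ∀ t, 0 ≤ t → omega N t ≤ g t + K := by
  obtain ⟨T, hT⟩ := eventually_atTop.1 h
  have hK := hN.omega_nonneg (le_max_right T 0)
  refine ⟨omega N (max T 0), hK, fun t ht => ?_⟩
  rcases le_total T t with h1 | h1
  · linarith [hT t h1]
  · linarith [hg t ht, hN.omega_mono ht (le_max_right T 0 : (0 : ℝ) ≤ max T 0)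
      (h1.trans (le_max_left T 0))]

lemma LC.rpow_inv_le_iff (hM : LC M) (hN : LC N) {d : ℕ} (hd : 0 < d) {C : ℝ} (hC : 0 < C)
    (i j : ℕ) : M i ^ (1 / (d : ℝ)) ≤ C * N j ↔
      Real.log (M i) ≤ d * (Real.log C + Real.log (N j)) := by
  have hd' : (0 : ℝ) < d := by exact_mod_cast hd
  rw [← Real.log_le_log_iff (Real.rpow_pos_of_pos (hM.pos i) _) (mul_pos hC (hN.pos j)),
    Real.log_rpow (hM.pos i), Real.log_mul hC.ne' (hN.pos j).ne', one_div,
    inv_mul_le_iff₀ hd']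

/-- The index d corresponds to ε = 1/d. Up to a constant, condition 1 bounds the j-th term of ω_N by
1/d times the term of ω_M with index dj; the converse evaluates ω_N ≤ ω_M/d + K at a point where the
duality for M_{dj} is attained. -/
lemma omega_isLittleO_iff_rpow_le (hM : LC M) (hN : LC N) :
    omega N =o[atTop] omega M ↔
      ∀ d : ℕ, 0 < d → ∃ C : ℝ, 1 ≤ C ∧ ∀ j : ℕ, M (d * j) ^ (1 / (d : ℝ)) ≤ C * N j := by
  constructor
  · intro h d hd
    have hd' : (0 : ℝ) < d := by exact_mod_cast hd
    obtain ⟨K, hK0, hK⟩ := hN.exists_omega_le_add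
      (fun t ht => mul_nonneg (inv_pos.2 hd').le (hM.omega_nonneg ht))
      (eventually_omega_le hM hN h (inv_pos.2 hd'))
    refine ⟨Real.exp K, Real.one_le_exp hK0, fun j => ?_⟩
    rw [hM.rpow_inv_le_iff hN hd (Real.exp_pos K), Real.log_exp]
    obtain ⟨t, ht, h1⟩ := hM.exists_log_le (d * j)
    have h2 := hN.mul_log_sub_le_omega ht j
    have h3 := mul_le_mul_of_nonneg_left (h2.trans (hK t ht.le)) hd'.le
    have e : (d : ℝ) * ((d : ℝ)⁻¹ * omega M t + K) = omega M t + d * K := by field_simp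
    push_cast at h1
    rw [e] at h3
    linarith
  · intro h
    refine omega_isLittleO_of hM hN fun ε hε => ?_
    obtain ⟨d, hd⟩ := exists_nat_gt (1 / ε)
    have hd' : (0 : ℝ) < d := (by positivity : 0 < 1 / ε).trans hd
    obtain ⟨C, hC, hCj⟩ := h d (by exact_mod_cast hd')
    refine ⟨0, Real.log C, ?_⟩
    filter_upwards [eventually_gt_atTop 0] with t ht
    refine hN.omega_le ht fun j => ?_
    have h1 := (hM.rpow_inv_le_iff hN (by exact_mod_cast hd') (by linarith) _ _).1 (hCj j)
    have h2 := hM.mul_log_sub_le_omega ht (d * j)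
    have h3 : (d : ℝ) * (j * Real.log t - Real.log (N j) - Real.log C) ≤ omega M t := by
      push_cast at h2; linarith
    have h4 : 1 < d * ε := by rwa [div_lt_iff₀ hε] at hd
    have h5 := hM.omega_nonneg ht.le
    have h6 : (d : ℝ) * (j * Real.log t - Real.log (N j) - Real.log C) ≤
        d * (ε * omega M t) := by nlinarith
    linarith [le_of_mul_le_mul_left h6 hd']

/-! ### Relations between weights -/

lemma exp_neg_isLittleO_iff {f g : ℝ → ℝ} :
    (fun t => Real.exp (-f t)) =o[atTop] (fun t => Real.exp (-g t)) ↔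
      Tendsto (fun t => f t - g t) atTop atTop := by
  rw [Real.isLittleO_exp_comp_exp_comp]
  refine iff_of_eq (congrArg (Tendsto · _ _) (funext fun t => ?_))
  ring

lemma strongLTPower_iff (hM : LC M) (hN : LC N) :
    hN.weight.StrongLTPower hM.weight ↔ omega N =o[atTop] omega M := by
  have key : ∀ (c : ℝ) (hc : 0 < c), hN.weight.StrongLT (hM.weight.power c hc) ↔
      Tendsto (fun t => c * omega M t - omega N t) atTop atTop := fun c hc => by
    rw [← exp_neg_isLittleO_iff, Weight.StrongLT]
    simp only [Weight.power, LC.weight, ← Real.exp_mul, neg_mul, mul_comm c]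
  simp only [Weight.StrongLTPower, key]
  constructor
  · intro h
    refine omega_isLittleO_of hM hN fun ε hε => ⟨0, 0, ?_⟩
    filter_upwards [(h ε hε).eventually_ge_atTop 0] with t ht
    linarith
  · intro h c hc
    -- Half of c ω_M dominates ω_N; the other half still tends to infinity.
    refine tendsto_atTop_mono' _ ?_ (hM.tendsto_omega.const_mul_atTop (half_pos hc))
    filter_upwards [eventually_omega_le hM hN h (half_pos hc)] with t ht
    linarith

lemma strongLTDilate_iff (hM : LC M) (hN : LC N) :
    hN.weight.StrongLTDilate hM.weight ↔ ∀ c : ℝ, 0 < c →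
      Tendsto (fun t => omega M (c * t) - omega N t) atTop atTop :=
  forall₂_congr fun _ _ => exp_neg_isLittleO_iff

/-- The function s ↦ ω_M(e^s) is convex and vanishes at 0, so its increment from log t to log(at) is
at least (log a / log(at)) ω_M(at), and ω_M outgrows every multiple of log. -/
lemma LC.tendsto_omega_sub (hM : LC M) {a : ℝ} (ha : 1 < a) :
    Tendsto (fun t => omega M (a * t) - omega M t) atTop atTop := by
  have hla := Real.log_pos ha
  refine tendsto_atTop.2 fun B => ?_
  have h1 := (tendsto_id.const_mul_atTop (show 0 < a by linarith)).eventually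
    (hM.eventually_mul_log_le_omega (B / Real.log a))
  filter_upwards [h1, eventually_gt_atTop 1] with t h1 ht
  simp only [id] at h1
  have hx : 0 < Real.log t := Real.log_pos ht
  have h3 : Real.log (a * t) = Real.log a + Real.log t :=
    Real.log_mul (by linarith) (by linarith)
  have hs : 0 < Real.log a + Real.log t := by linarith
  have h2 := hM.omega_convex.2 (Set.mem_univ 0) (Set.mem_univ (Real.log a + Real.log t))
    (show 0 ≤ Real.log a / (Real.log a + Real.log t) by positivity)
    (show 0 ≤ Real.log t / (Real.log a + Real.log t) by positivity) (by field_simp)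
  simp only [smul_eq_mul, mul_zero, zero_add, Real.exp_zero,
    hM.omega_eq_zero zero_le_one le_rfl] at h2
  rw [div_mul_cancel₀ _ hs.ne', ← h3, Real.exp_log (by linarith), Real.exp_log (by nlinarith),
    div_mul_eq_mul_div, le_div_iff₀ (h3 ▸ hs), h3] at h2
  rw [h3, div_mul_eq_mul_div, div_le_iff₀ hla] at h1
  have h4 : B * (Real.log a + Real.log t) ≤
      (omega M (a * t) - omega M t) * (Real.log a + Real.log t) := by linarith
  exact le_of_mul_le_mul_right h4 hs

lemma seqStrongLT_iff_strongLTDilate (hM : LC M) (hN : LC N) :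
    SeqStrongLT M N ↔ hN.weight.StrongLTDilate hM.weight := by
  have hlog : ∀ {C h : ℝ}, 0 < C → 0 < h → ∀ j : ℕ, M j ≤ C * h ^ j * N j ↔
      Real.log (M j) ≤ Real.log C + j * Real.log h + Real.log (N j) := by
    intro C h hC hh j
    have := hN.pos j
    rw [← Real.log_le_log_iff (hM.pos j) (by positivity),
      Real.log_mul (by positivity) this.ne', Real.log_mul hC.ne' (by positivity), Real.log_pow]
  rw [strongLTDilate_iff hM hN]
  constructor
  · intro h c hc
    -- With h = c/2 one gets ω_N(t) ≤ ω_M(ct/2) + log C; the remaining dilation by 2 makes the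
    -- difference diverge.
    obtain ⟨C, hC, hCj⟩ := h (c / 2) (by positivity)
    refine tendsto_atTop_mono' _ ?_ (tendsto_atTop_add_const_right _ (-Real.log C)
      ((hM.tendsto_omega_sub one_lt_two).comp
        (tendsto_id.const_mul_atTop (show 0 < c / 2 by positivity))))
    filter_upwards [eventually_gt_atTop 0] with t ht
    have h1 : omega N t ≤ omega M (c / 2 * t) + Real.log C := hN.omega_le ht fun j => by
      have h2 := (hlog (by linarith) (by positivity) j).1 (hCj j)
      have h3 := hM.mul_log_sub_le_omega (show 0 < c / 2 * t by positivity) j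
      rw [Real.log_mul (by positivity) ht.ne'] at h3
      linarith
    have e : 2 * (c / 2 * t) = c * t := by ring
    simp only [Function.comp, id, e]
    linarith
  · intro h r hr
    obtain ⟨K, hK0, hK⟩ := hN.exists_omega_le_add (g := fun t => omega M (r * t))
      (fun t ht => hM.omega_nonneg (by positivity))
      (by filter_upwards [(h r hr).eventually_ge_atTop 0] with t ht using by linarith)
    refine ⟨Real.exp K, Real.one_le_exp hK0, fun j => ?_⟩
    rw [hlog (Real.exp_pos K) hr, Real.log_exp]
    obtain ⟨t, ht, h1⟩ := hM.exists_log_le j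
    -- At t/r the dilation by r lands on the point t where the duality for M_j is attained.
    have h2 := hK (t / r) (by positivity)
    have h3 := hN.mul_log_sub_le_omega (show 0 < t / r by positivity) j
    rw [Real.log_div ht.ne' hr.ne'] at h3
    simp only [mul_div_cancel₀ t hr.ne'] at h2
    linarith

/-! ### Growth conditions -/

lemma ModerateGrowth.exists_log_le (hM : LC M) (h : ModerateGrowth M) (d : ℕ) :
    ∃ D : ℝ, ∀ j : ℕ, Real.log (M (d * j)) ≤ j * D + d * Real.log (M j) := by
  obtain ⟨C, hC, h⟩ := h
  induction d with
  | zero => exact ⟨0, fun j => by simp [hM.zero]⟩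
  | succ d ih =>
    obtain ⟨D, hD⟩ := ih
    refine ⟨D + (d + 1) * Real.log C, fun j => ?_⟩
    have h1 := Real.log_le_log (hM.pos _) (h (d * j) j)
    rw [Real.log_mul (by have := hM.pos (d * j); positivity) (hM.pos _).ne',
      Real.log_mul (by positivity) (hM.pos _).ne', Real.log_pow] at h1
    have h2 := hD j
    rw [add_one_mul]
    push_cast at h1 ⊢
    linarith

/-- Iterated moderate growth replaces the index dj by a d-th power at the cost of e^{Dj}. Taking h =
e^{-D/d} in M ◁ N cancels this factor: at index j if M has moderate growth, at index dj if N does.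
-/
lemma SeqStrongLT.rpow_le (hM : LC M) (hN : LC N) (hg : ModerateGrowth M ∨ ModerateGrowth N)
    (h : SeqStrongLT M N) (d : ℕ) (hd : 0 < d) :
    ∃ C : ℝ, 1 ≤ C ∧ ∀ j : ℕ, M (d * j) ^ (1 / (d : ℝ)) ≤ C * N j := by
  have hd' : (1 : ℝ) ≤ d := by exact_mod_cast hd
  have hlog : ∀ x : ℝ, ∃ C : ℝ, 0 ≤ C ∧ ∀ j : ℕ,
      Real.log (M j) ≤ C + j * x + Real.log (N j) := fun x => by
    obtain ⟨C, hC, hCj⟩ := h (Real.exp x) (Real.exp_pos x)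
    refine ⟨Real.log C, Real.log_nonneg hC, fun j => ?_⟩
    have := hN.pos j
    have h1 := Real.log_le_log (hM.pos j) (hCj j)
    rwa [Real.log_mul (by positivity) this.ne', Real.log_mul (by positivity) (by positivity),
      Real.log_pow, Real.log_exp] at h1
  suffices ∃ C : ℝ, 0 ≤ C ∧ ∀ j : ℕ, Real.log (M (d * j)) ≤ d * (C + Real.log (N j)) by
    obtain ⟨C, hC, hj⟩ := this
    refine ⟨Real.exp C, Real.one_le_exp hC, fun j => ?_⟩
    rw [hM.rpow_inv_le_iff hN hd (Real.exp_pos C), Real.log_exp]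
    exact hj j
  rcases hg with hg | hg
  · obtain ⟨D, hD⟩ := hg.exists_log_le hM d
    obtain ⟨C, hC, hCj⟩ := hlog (-(D / d))
    refine ⟨C, hC, fun j => ?_⟩
    have h1 := mul_le_mul_of_nonneg_left (hCj j) (show (0 : ℝ) ≤ d by linarith)
    have e : (d : ℝ) * (C + j * -(D / d) + Real.log (N j)) =
        d * C - j * D + d * Real.log (N j) := by field_simp; ring
    linarith [hD j]
  · obtain ⟨D, hD⟩ := hg.exists_log_le hN d
    obtain ⟨C, hC, hCj⟩ := hlog (-(D / d))
    refine ⟨C, hC, fun j => ?_⟩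
    have h1 := hCj (d * j)
    have e : ((d * j : ℕ) : ℝ) * -(D / d) = -(j * D) := by push_cast; field_simp
    nlinarith [hD j]

/-- A real a strictly between 1 and the lower limit gives M_{Lj} ≥ a^{Lj} M_j^L for large j. -/
lemma RootGrowth.exists_log_le (hM : LC M) (h : RootGrowth M) :
    ∃ L : ℕ, 0 < L ∧ ∃ a : ℝ, 1 < a ∧ ∀ᶠ j : ℕ in atTop,
      (L * j : ℕ) * Real.log a + L * Real.log (M j) ≤ Real.log (M (L * j)) := by
  obtain ⟨L, hL, h⟩ := h
  obtain ⟨a, ha1, ha⟩ := EReal.lt_iff_exists_real_btwn.1 h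
  have ha1 : 1 < a := by exact_mod_cast ha1
  refine ⟨L, hL, a, ha1, ?_⟩
  filter_upwards [eventually_lt_of_lt_liminf ha, eventually_gt_atTop 0] with j hj hj0
  have hj := EReal.coe_lt_coe_iff.1 hj
  have hp := Real.rpow_pos_of_pos (hM.pos j) (1 / (j : ℝ))
  rw [lt_div_iff₀ hp] at hj
  have h1 := Real.log_le_log (by positivity) hj.le
  have hL' : (0 : ℝ) < L := by exact_mod_cast hL
  have hj' : (0 : ℝ) < j := by exact_mod_cast hj0
  rw [Real.log_mul (by positivity) hp.ne', Real.log_rpow (hM.pos _), Real.log_rpow (hM.pos _)] at h1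
  have h2 := mul_le_mul_of_nonneg_left h1 (show 0 ≤ ((L * j : ℕ) : ℝ) by positivity)
  push_cast at h2 ⊢
  field_simp at h2
  linarith

lemma RootGrowth.eventually_omega_mul_le (hM : LC M) (h : RootGrowth M) :
    ∃ a : ℝ, 1 < a ∧ ∃ K : ℝ, 0 < K ∧ ∀ᶠ t in atTop, omega M (a * t) ≤ K * omega M t := by
  obtain ⟨L, hL, a, ha, h⟩ := h.exists_log_le hM
  obtain ⟨J, hJ⟩ := eventually_atTop.1 h
  have hL' : (0 : ℝ) < L := by exact_mod_cast hL
  -- For j ≥ J the term of ω_M(at) with index Lj is at most L ω_M(t), because the factor a^{Lj}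
  -- cancels. Rounding to multiples of L costs L log(at), the indices j ≤ J at most LJ log(at), and
  -- log(at) ≤ 2 ω_M(t).
  refine ⟨a, ha, L + (L + L * J) * 2, by positivity, ?_⟩
  filter_upwards [hM.eventually_mul_log_le_omega 1,
    Real.tendsto_log_atTop.eventually_ge_atTop (Real.log a), eventually_ge_atTop 1]
    with t h1 h2 ht
  have hl := Real.log_nonneg ht
  have hw := hM.omega_nonneg (show 0 ≤ t by linarith)
  have hat : 1 ≤ a * t := by nlinarith
  have e : Real.log (a * t) = Real.log a + Real.log t :=
    Real.log_mul (by linarith) (by linarith)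
  have h3 : omega M (a * t) ≤ L * Real.log (a * t) +
      (L * omega M t + L * J * Real.log (a * t)) := by
    refine hM.omega_le_of_multiples hL hat fun j => ?_
    rcases le_total J j with hj | hj
    · have h4 := hJ j hj
      have h5 := mul_le_mul_of_nonneg_left
        (hM.mul_log_sub_le_omega (show 0 < t by linarith) j) hL'.le
      have h6 : 0 ≤ L * J * Real.log (a * t) := mul_nonneg (by positivity) (Real.log_nonneg hat)
      rw [e] at h6 ⊢
      push_cast at h4 ⊢
      linarith
    · have h4 : ((L * j : ℕ) : ℝ) ≤ L * J := by exact_mod_cast Nat.mul_le_mul_left L hj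
      have h5 := mul_le_mul_of_nonneg_right h4 (Real.log_nonneg hat)
      have := hM.log_nonneg (L * j)
      nlinarith
  have h4 : Real.log (a * t) ≤ 2 * omega M t := by linarith
  have h5 := mul_le_mul_of_nonneg_left h4 (show 0 ≤ (L : ℝ) + L * J by positivity)
  linarith

/-- Root growth forces `ω_M(bt) = O(ω_M(t))` for every dilation factor. -/
lemma RootGrowth.eventually_omega_dilate_le (hM : LC M) (h : RootGrowth M)
    {b : ℝ} (hb : 0 < b) :
    ∃ K : ℝ, 0 < K ∧ ∀ᶠ t in atTop, omega M (b * t) ≤ K * omega M t := by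
  obtain ⟨a, ha, K, hK, h⟩ := h.eventually_omega_mul_le hM
  have hpow : ∀ n : ℕ, ∀ᶠ t in atTop, omega M (a ^ n * t) ≤ K ^ n * omega M t := by
    intro n
    induction n with
    | zero => simp
    | succ n ih =>
      filter_upwards [ih, (tendsto_id.const_mul_atTop
        (show 0 < a ^ n by positivity)).eventually h] with t h1 h2
      simp only [id] at h2
      rw [pow_succ' a, pow_succ' K, mul_assoc, mul_assoc]
      exact h2.trans (mul_le_mul_of_nonneg_left h1 hK.le)
  obtain ⟨n, hn⟩ := pow_unbounded_of_one_lt b ha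
  refine ⟨K ^ n, by positivity, ?_⟩
  filter_upwards [hpow n, eventually_ge_atTop 0] with t h1 ht
  exact (hM.omega_mono (Set.mem_Ici.2 (by positivity)) (Set.mem_Ici.2 (by positivity))
    (mul_le_mul_of_nonneg_right hn.le ht)).trans h1

/-- Passing from t to ct costs a factor K, which the little-o with ε = 1/(2K) absorbs. The dilation
is made in ω_M after the comparison, or in ω_N before it, according to which sequence has root
growth. -/
lemma strongLTDilate_of_isLittleO (hM : LC M) (hN : LC N) (hg : RootGrowth M ∨ RootGrowth N)
    (h : omega N =o[atTop] omega M) : hN.weight.StrongLTDilate hM.weight := by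
  refine (strongLTDilate_iff hM hN).2 fun c hc => ?_
  have hct : Tendsto (fun t : ℝ => c * t) atTop atTop := tendsto_id.const_mul_atTop hc
  have e : ∀ t, c⁻¹ * (c * t) = t := fun t => by field_simp
  suffices ∀ᶠ t in atTop, omega N t ≤ 1 / 2 * omega M (c * t) by
    refine tendsto_atTop_mono' _ ?_ ((hM.tendsto_omega.comp hct).const_mul_atTop one_half_pos)
    filter_upwards [this] with t ht
    simp only [Function.comp]
    linarith
  rcases hg with hg | hg
  · obtain ⟨K, hK, hKt⟩ := hg.eventually_omega_dilate_le hM (inv_pos.2 hc)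
    filter_upwards [hct.eventually hKt,
      eventually_omega_le hM hN h (show 0 < 1 / (2 * K) by positivity)] with t h1 h2
    rw [e] at h1
    calc omega N t ≤ 1 / (2 * K) * omega M t := h2
      _ ≤ 1 / (2 * K) * (K * omega M (c * t)) := by gcongr
      _ = 1 / 2 * omega M (c * t) := by field_simp
  · obtain ⟨K, hK, hKt⟩ := hg.eventually_omega_dilate_le hN (inv_pos.2 hc)
    filter_upwards [hct.eventually hKt, hct.eventually
      (eventually_omega_le hM hN h (show 0 < 1 / (2 * K) by positivity))] with t h1 h2
    rw [e] at h1
    calc omega N t ≤ K * omega N (c * t) := h1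
      _ ≤ K * (1 / (2 * K) * omega M (c * t)) := by gcongr
      _ = 1 / 2 * omega M (c * t) := by field_simp

end Sequences

/-! ### Weighted spaces -/

section Spaces

variable {v w : Weight}

lemma HInf.le_norm (f : HInf v) (z : ℂ) : ‖f.1 z‖ * v ‖z‖ ≤ ‖f‖ := le_ciSup f.2 z

lemma HInf.norm_le {f : HInf v} {B : ℝ} (h : ∀ z, ‖f.1 z‖ * v ‖z‖ ≤ B) : ‖f‖ ≤ B := ciSup_le h

lemma HInf.continuousIncl_of_le {A : ℝ} (h : ∀ t, 0 ≤ t → w t ≤ A * v t) :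
    ContinuousIncl (HInf v) (HInf w) := by
  have hA : 0 ≤ A := le_of_mul_le_mul_right
    (by simpa using (w.pos 0 le_rfl).le.trans (h 0 le_rfl)) (v.pos 0 le_rfl)
  have key : ∀ (f : HInf v) (z : ℂ), ‖f.1 z‖ * w ‖z‖ ≤ A * ‖f‖ := fun f z =>
    calc ‖f.1 z‖ * w ‖z‖ ≤ ‖f.1 z‖ * (A * v ‖z‖) := by gcongr; exact h _ (norm_nonneg z)
      _ = A * (‖f.1 z‖ * v ‖z‖) := by ring
      _ ≤ A * ‖f‖ := by gcongr; exact HInf.le_norm f z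
  have hle : HInf v ≤ HInf w := fun f hf =>
    ⟨A * ‖(⟨f, hf⟩ : HInf v)‖, by rintro _ ⟨z, rfl⟩; exact key ⟨f, hf⟩ z⟩
  exact ⟨hle, ((Submodule.inclusion hle).mkContinuous A fun f =>
    HInf.norm_le (key f)).continuous⟩

/-- Testing a continuous inclusion on monomials. -/
lemma ContinuousIncl.exists_pow_mul_le (h : ContinuousIncl (HInf v) (HInf w)) :
    ∃ A : ℝ, 0 < A ∧ ∀ (j : ℕ) (B : ℝ), (∀ t, 0 ≤ t → t ^ j * v t ≤ B) →
      ∀ t, 0 ≤ t → t ^ j * w t ≤ A * B := by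
  obtain ⟨hle, hc⟩ := h
  let T : HInf v →L[ℂ] HInf w := ⟨Submodule.inclusion hle, hc⟩
  refine ⟨‖T‖ + 1, by positivity, fun j B hB t ht => ?_⟩
  have key : ∀ z : ℂ, ‖Entire.mk (fun z => z ^ j) (by fun_prop) z‖ * v ‖z‖ ≤ B := fun z => by
    simpa using hB ‖z‖ (norm_nonneg z)
  let f : HInf v := ⟨Entire.mk (fun z => z ^ j) (by fun_prop),
    ⟨B, by rintro _ ⟨z, rfl⟩; exact key z⟩⟩
  have hf : ‖f‖ ≤ B := HInf.norm_le key
  have h1 := HInf.le_norm (T f) t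
  have h2 : ‖(T f).1 t‖ * w ‖(t : ℂ)‖ = t ^ j * w t := by
    change ‖(t : ℂ) ^ j‖ * w ‖(t : ℂ)‖ = _
    rw [norm_pow, Complex.norm_of_nonneg ht]
  rw [h2] at h1
  calc t ^ j * w t ≤ ‖T f‖ := h1
    _ ≤ ‖T‖ * ‖f‖ := T.le_opNorm f
    _ ≤ (‖T‖ + 1) * B := by nlinarith [norm_nonneg T, norm_nonneg f]

lemma ContinuousIncl.trans {R S T : Submodule ℂ Entire} [TopologicalSpace R] [TopologicalSpace S]
    [TopologicalSpace T] (h : ContinuousIncl R S) (h' : ContinuousIncl S T) :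
    ContinuousIncl R T :=
  ⟨h.1.trans h'.1, h'.2.comp h.2⟩

lemma continuousIncl_HInd (V : ℕ+ → Weight) (n : ℕ+) : ContinuousIncl (HInf (V n)) (HInd V) :=
  ⟨le_HInd V n, continuous_sInf_rng.2 fun _ ht => ht.1 n⟩

lemma HProj_continuousIncl (V : ℕ+ → Weight) (n : ℕ+) : ContinuousIncl (HProj V) (HInf (V n)) :=
  ⟨HProj_le V n, continuous_iInf_dom (i := n) continuous_induced_dom⟩

/-- The universal properties of the inductive and projective limits. -/
lemma HInd_continuousIncl_HProj {V W : ℕ+ → Weight}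
    (h : ∀ m n, ContinuousIncl (HInf (V m)) (HInf (W n))) :
    ContinuousIncl (HInd V) (HProj W) := by
  have hle : ∀ n, HInd V ≤ HInf (W n) := fun n => iSup_le fun m => (h m n).1
  refine ⟨le_iInf hle, continuous_iInf_rng.2 fun n => continuous_induced_rng.2 ?_⟩
  let T : HInd V →ₗ[ℂ] HInf (W n) := Submodule.inclusion (hle n)
  -- The topology pulled back along the inclusion is one of the admissible locally convex
  -- topologies, so the inductive topology is finer than it.
  refine continuous_sInf_dom (t := TopologicalSpace.induced T inferInstance) ⟨?_, ?_, ?_, ?_⟩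
    continuous_induced_dom
  · exact fun m => continuous_induced_rng.2 (h m n).2
  · exact topologicalAddGroup_induced T
  · exact continuousSMul_induced T
  · exact LocallyConvexSpace.induced (T.restrictScalars ℝ)

/-! ### Inclusions between the spaces of powers of v_N and v_M -/

variable {M N : ℕ → ℝ}

lemma LC.weight_power_apply (hM : LC M) {c : ℝ} (hc : 0 < c) (t : ℝ) :
    hM.weight.power c hc t = Real.exp (-(c * omega M t)) := by
  simp only [Weight.power, LC.weight, ← Real.exp_mul, neg_mul, mul_comm c]

lemma continuousIncl_power (hM : LC M) (hN : LC N) (h : omega N =o[atTop] omega M)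
    {c c' : ℝ} (hc : 0 < c) (hc' : 0 < c') :
    ContinuousIncl (HInf (hN.weight.power c hc)) (HInf (hM.weight.power c' hc')) := by
  obtain ⟨K, -, hK⟩ := hN.exists_omega_le_add
    (fun t ht => mul_nonneg (div_pos hc' hc).le (hM.omega_nonneg ht))
    (eventually_omega_le hM hN h (div_pos hc' hc))
  refine HInf.continuousIncl_of_le (A := Real.exp (c * K)) fun t ht => ?_
  rw [LC.weight_power_apply, LC.weight_power_apply, ← Real.exp_add, Real.exp_le_exp]
  have h1 := mul_le_mul_of_nonneg_left (hK t ht) hc.le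
  have e : c * (c' / c * omega M t + K) = c' * omega M t + c * K := by field_simp
  linarith

/-- One source exponent and arbitrarily small target exponents suffice, a form that covers both
condition 5 and the exponents 1/n of condition 6. -/
lemma isLittleO_of_continuousIncl (hM : LC M) (hN : LC N) {c : ℝ} (hc : 0 < c)
    (h : ∀ ε : ℝ, 0 < ε → ∃ (c' : ℝ) (hc' : 0 < c'), c' ≤ ε ∧
      ContinuousIncl (HInf (hN.weight.power c hc)) (HInf (hM.weight.power c' hc'))) :
    omega N =o[atTop] omega M := by
  obtain ⟨m, hm⟩ := exists_nat_gt (1 / c)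
  have hm' : (0 : ℝ) < m := (by positivity : 0 < 1 / c).trans hm
  rw [div_lt_iff₀ hc] at hm
  refine omega_isLittleO_of hM hN fun ε hε => ?_
  -- The monomial estimate is later raised to the power m, which turns c' into m c' ≤ ε.
  obtain ⟨c', hc', hle, hincl⟩ := h (ε / m) (by positivity)
  obtain ⟨A, hA, hAj⟩ := hincl.exists_pow_mul_le
  refine ⟨m, m * Real.log A, ?_⟩
  filter_upwards [eventually_ge_atTop 1] with t ht
  have ht0 : 0 < t := by linarith
  rw [add_assoc]
  refine hN.omega_le_of_multiples (by exact_mod_cast hm') ht fun j => ?_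
  -- Since cm > 1, v_N^c ≤ v_N^{1/m}, and s^{mj} v_N(s) ≤ N_{mj} by the definition of ω_N.
  have hB : ∀ s, 0 ≤ s → s ^ j * hN.weight.power c hc s ≤
      Real.exp (Real.log (N (m * j)) / m) := fun s hs => by
    rw [hN.weight_power_apply]
    rcases hs.eq_or_lt with rfl | hs
    · calc (0 : ℝ) ^ j * Real.exp (-(c * omega N 0)) ≤ 1 * 1 := by
            gcongr
            · exact pow_le_one₀ le_rfl zero_le_one
            · simp [omega]
        _ ≤ _ := by
            rw [one_mul]
            exact Real.one_le_exp (div_nonneg (hN.log_nonneg _) hm'.le)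
    · rw [← Real.exp_log (pow_pos hs j), ← Real.exp_add, Real.exp_le_exp, Real.log_pow,
        le_div_iff₀ hm']
      have h1 := hN.mul_log_sub_le_omega hs (m * j)
      have h2 := hN.omega_nonneg hs.le
      push_cast at h1
      nlinarith
  have h1 := hAj j _ hB t ht0.le
  rw [hM.weight_power_apply, ← Real.exp_log (pow_pos ht0 j), ← Real.exp_log hA, ← Real.exp_add,
    ← Real.exp_add, Real.exp_le_exp, Real.log_pow] at h1
  have h2 := mul_le_mul_of_nonneg_left h1 hm'.le
  have e : (m : ℝ) * (Real.log A + Real.log (N (m * j)) / m) =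
    m * Real.log A + Real.log (N (m * j)) := by field_simp
  rw [le_div_iff₀ hm'] at hle
  have h3 := mul_le_mul_of_nonneg_right hle (hM.omega_nonneg ht0.le)
  push_cast
  linarith

/-- The equivalences that hold without growth conditions. -/
theorem tfae_exponential (hM : LC M) (hN : LC N) :
    [ ∀ d : ℕ, 0 < d → ∃ C : ℝ, 1 ≤ C ∧ ∀ j : ℕ, M (d * j) ^ (1 / (d : ℝ)) ≤ C * N j,
      hN.weight.StrongLTPower hM.weight,
      omega N =o[atTop] omega M,
      ∀ (c c' : ℝ) (hc : 0 < c) (hc' : 0 < c'), ContinuousIncl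
        (HInf (hN.weight.power c hc)) (HInf (hM.weight.power c' hc')),
      ∃ (c : ℝ) (hc : 0 < c), ∀ (c' : ℝ) (hc' : 0 < c'), ContinuousIncl
        (HInf (hN.weight.power c hc)) (HInf (hM.weight.power c' hc')),
      ContinuousIncl (HInd hN.weight.lowerPowers) (HProj hM.weight.upperPowers)].TFAE := by
  tfae_have 3 ↔ 1 := omega_isLittleO_iff_rpow_le hM hN
  tfae_have 2 ↔ 3 := strongLTPower_iff hM hN
  tfae_have 3 → 4 := fun h c c' hc hc' => continuousIncl_power hM hN h hc hc'
  tfae_have 4 → 5 := fun h => ⟨1, one_pos, fun c' hc' => h 1 c' one_pos hc'⟩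
  tfae_have 5 → 3 := fun ⟨c, hc, h⟩ =>
    isLittleO_of_continuousIncl hM hN hc fun ε hε => ⟨ε, hε, le_rfl, h ε hε⟩
  tfae_have 4 → 6 := fun h => HInd_continuousIncl_HProj fun m n => h _ _ _ _
  tfae_have 6 → 3 := fun h => by
    -- The first step of the inductive system already suffices as source; the target is a step n + 1
    -- with 1/(n + 1) < ε.
    refine isLittleO_of_continuousIncl hM hN (c := ((1 : ℕ+) : ℝ)) (by positivity)
      fun ε hε => ?_
    obtain ⟨n, hn⟩ := exists_nat_one_div_lt hε
    refine ⟨1 / ((n.succPNat : ℕ+) : ℝ), by positivity, by simpa using hn.le, ?_⟩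
    exact (continuousIncl_HInd hN.weight.lowerPowers 1).trans
      (h.trans (HProj_continuousIncl hM.weight.upperPowers n.succPNat))
  tfae_finish

end Spaces

end WeightedEntire

theorem mainTheorem4 (M N : ℕ → ℝ) (hM : WeightedEntire.LC M) (hN : WeightedEntire.LC N) :
    [ ∀ d : ℕ, 0 < d → ∃ C : ℝ, 1 ≤ C ∧ ∀ j : ℕ, M (d * j) ^ (1 / (d : ℝ)) ≤ C * N j,
      hN.weight.StrongLTPower hM.weight,
      WeightedEntire.omega N =o[atTop] WeightedEntire.omega M,
      ∀ (c c' : ℝ) (hc : 0 < c) (hc' : 0 < c'), WeightedEntire.ContinuousIncl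
        (WeightedEntire.HInf (hN.weight.power c hc))
        (WeightedEntire.HInf (hM.weight.power c' hc')),
      ∃ (c : ℝ) (hc : 0 < c), ∀ (c' : ℝ) (hc' : 0 < c'), WeightedEntire.ContinuousIncl
        (WeightedEntire.HInf (hN.weight.power c hc))
        (WeightedEntire.HInf (hM.weight.power c' hc')),
      WeightedEntire.ContinuousIncl
        (WeightedEntire.HInd hN.weight.lowerPowers)
        (WeightedEntire.HProj hM.weight.upperPowers)].TFAE ∧
    ((WeightedEntire.ModerateGrowth M ∨ WeightedEntire.ModerateGrowth N) →
      (WeightedEntire.RootGrowth M ∨ WeightedEntire.RootGrowth N) →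
      [ ∀ d : ℕ, 0 < d → ∃ C : ℝ, 1 ≤ C ∧ ∀ j : ℕ, M (d * j) ^ (1 / (d : ℝ)) ≤ C * N j,
        hN.weight.StrongLTPower hM.weight,
        WeightedEntire.omega N =o[atTop] WeightedEntire.omega M,
        ∀ (c c' : ℝ) (hc : 0 < c) (hc' : 0 < c'), WeightedEntire.ContinuousIncl
          (WeightedEntire.HInf (hN.weight.power c hc))
          (WeightedEntire.HInf (hM.weight.power c' hc')),
        ∃ (c : ℝ) (hc : 0 < c), ∀ (c' : ℝ) (hc' : 0 < c'), WeightedEntire.ContinuousIncl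
          (WeightedEntire.HInf (hN.weight.power c hc))
          (WeightedEntire.HInf (hM.weight.power c' hc')),
        WeightedEntire.ContinuousIncl
          (WeightedEntire.HInd hN.weight.lowerPowers)
          (WeightedEntire.HProj hM.weight.upperPowers),
        WeightedEntire.SeqStrongLT M N,
        hN.weight.StrongLTDilate hM.weight].TFAE) := by
  have h := WeightedEntire.tfae_exponential hM hN
  refine ⟨h, fun hmg hrg => ?_⟩
  tfae_have 1 ↔ 2 := h.out 0 1
  tfae_have 1 ↔ 3 := h.out 0 2
  tfae_have 1 ↔ 4 := h.out 0 3
  tfae_have 1 ↔ 5 := h.out 0 4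
  tfae_have 1 ↔ 6 := h.out 0 5
  -- The cycle 7 → 1 ↔ 3 → 8 ↔ 7 uses moderate growth only in its first arrow and root growth only
  -- in 3 → 8.
  tfae_have 7 ↔ 8 := WeightedEntire.seqStrongLT_iff_strongLTDilate hM hN
  tfae_have 7 → 1 := fun h' => h'.rpow_le hM hN hmg
  tfae_have 3 → 8 := WeightedEntire.strongLTDilate_of_isLittleO hM hN hrg
  tfae_finish
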